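/- Let $C>0$. For $n\ge 1$ consider the Gaussian sequence model in which $X$ and $\tilde X$ are independent $N(\theta,\frac1n I_n)$ vectors in $\mathbb R^n$ (that is, $m=n$), with $\theta$ in the $\mathcal L^2$ ball $\Theta_n(C)=\{\theta\in\mathbb R^n:\sum_{i=1}^n\theta_i^2\le C\}$. A predictive density $\hat p(\tilde x\mid x)$ is a jointly measurable non-negative function with $\int\hat p(\tilde x\mid x)\,d\tilde x=1$ for every $x$; its Kullback–Leibler risk is $R(\theta,\hat p)=\frac1n E_\theta\log\frac{p(\tilde X\mid\theta)}{\hat p(\tilde X\mid X)}\in[0,\infty]$. Define * $R(\Theta_n(C))=\inf_{\hat p}\sup_{\theta\in\Theta_n(C)}R(\theta,\hat p)$, over all predictive densities (overall minimax risk); * $R_L(\Theta_n(C))=\inf_S\sup_{\theta\in\Theta_n(C)}R(\theta,\hat p_S)$, where $S=\mathrm{diag}(s_1,\dots,s_n)$ ranges over the diagonal matrices with $s_i\ge0$ and $\hat p_S$ is the Bayes predictive density under the prior $N(0,S)$ (linear minimax risk); * $R_P(\Theta_n(C))=\inf_{\hat\theta}\sup_{\theta\in\Theta_n(C)}R(\theta,p(\cdot\mid\hat\theta))$,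 over all measurable estimators $\hat\theta=\hat\theta(X)\in\mathbb R^n$ (plug-in minimax risk); * $R_Q(\Theta_n(C))=\inf_{\hat\theta}\sup_{\theta\in\Theta_n(C)}E_\theta\|\hat\theta(X)-\theta\|^2$ (squared-error minimax risk). Then $$\lim_{n\to\infty}R(\Theta_n(C))=\lim_{n\to\infty}R_L(\Theta_n(C))=\tfrac12\log\frac{1+2C}{1+C}.$$ For every $n\ge1$, every measurable estimator $\hat\theta$ and every $\theta\in\mathbb R^n$, $R(\theta,p(\cdot\mid\hat\theta))=\frac12E_\theta\|\hat\theta(X)-\theta\|^2$; consequently $R_P(\Theta_n(C))=\frac12R_Q(\Theta_n(C))$. Moreover $$\lim_{n\to\infty}R_Q(\Theta_n(C))=\frac{C}{1+C},\qquad \lim_{n\to\infty}R_P(\Theta_n(C))=\frac{C}{2(1+C)}.$$ The overall minimax risk is asymptotically strictly smaller than the plug-in minimax risk: $\frac12\log\frac{1+2C}{1+C}<\frac{C}{2(1+C)}$, and hence $R(\Theta_n(C))<R_P(\Theta_n(C))$ for all sufficiently large $n$. -/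

import Mathlib

open MeasureTheory ProbabilityTheory InformationTheory Filter Topology
open scoped ENNReal NNReal

namespace PredDensity

noncomputable section

/-- The law `N(θ, v I_n)` on `ℝⁿ`: independent coordinates, the `i`-th one `N(θ_i, v)`. -/
def gaussLaw {n : ℕ} (v : ℝ≥0) (θ : Fin n → ℝ) : Measure (Fin n → ℝ) :=
  Measure.pi fun i => gaussianReal (θ i) v

/-- The Lebesgue density `p(x | θ)` of `N(θ, v I_n)` (for `v ≠ 0`). -/
def gaussDensity {n : ℕ} (v : ℝ≥0) (θ x : Fin n → ℝ) : ℝ≥0∞ :=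
  ∏ i, gaussianPDF (θ i) v (x i)

/-- The noise level `v_k = 1 / k`. -/
def noise (k : ℕ) : ℝ≥0 := (k : ℝ≥0)⁻¹

/-- `p̂ x y` is a predictive density `p̂(y | x)`: jointly measurable, nonnegative, and for every
observation `x` a probability density in `y` with respect to Lebesgue measure. -/
structure IsPredictiveDensity {n : ℕ} (p : (Fin n → ℝ) → (Fin n → ℝ) → ℝ≥0∞) : Prop where
  measurable : Measurable (Function.uncurry p)
  lintegral_eq_one : ∀ x, ∫⁻ y, p x y = 1

/-- The Kullback-Leibler risk in the Gaussian sequence model `X ~ N(θ, v_n I_n)`,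
`X̃ ~ N(θ, v_m I_n)` independent:
`R(θ, p̂) = (1/m) E log (p(X̃ | θ) / p̂(X̃ | X))`, that is, `1/m` times the mean over `X` of the
Kullback-Leibler divergence from the law of `X̃` to the predictive distribution `p̂(y | X) dy`. -/
def klRisk {n : ℕ} (m : ℕ) (θ : Fin n → ℝ) (p : (Fin n → ℝ) → (Fin n → ℝ) → ℝ≥0∞) : ℝ≥0∞ :=
  (m : ℝ≥0∞)⁻¹ *
    ∫⁻ x, klDiv (gaussLaw (noise m) θ) (volume.withDensity (p x)) ∂(gaussLaw (noise n) θ)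

/-- The `L²` ball `∑ θ_i² ≤ C`. -/
def l2Ball (n : ℕ) (C : ℝ) : Set (Fin n → ℝ) := {θ | ∑ i, θ i ^ 2 ≤ C}

/-- The minimax risk `R(Θ)` over all predictive densities. -/
def minimaxRisk (n m : ℕ) (Θ : Set (Fin n → ℝ)) : ℝ≥0∞ :=
  ⨅ (p : (Fin n → ℝ) → (Fin n → ℝ) → ℝ≥0∞) (_ : IsPredictiveDensity p), ⨆ θ ∈ Θ, klRisk m θ p

/-- The Gaussian prior `π_S = N(0, diag(s_1, …, s_n))`, with `s_i ≥ 0`; a coordinate with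
`s_i = 0` is a point mass at `0`. -/
def gaussPrior {n : ℕ} (s : Fin n → ℝ≥0) : Measure (Fin n → ℝ) :=
  Measure.pi fun i => gaussianReal 0 (s i)

/-- The linear predictive density: the Bayes predictive density under the prior `π_S`,
`p̂_S(y | x) = ∫ p(x | θ) p(y | θ) dπ_S(θ) / ∫ p(x | θ) dπ_S(θ)`. -/
def linearDensity {n : ℕ} (m : ℕ) (s : Fin n → ℝ≥0) (x y : Fin n → ℝ) : ℝ≥0∞ :=
  (∫⁻ θ, gaussDensity (noise n) θ x * gaussDensity (noise m) θ y ∂(gaussPrior s)) /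
    ∫⁻ θ, gaussDensity (noise n) θ x ∂(gaussPrior s)

/-- The linear minimax risk `R_L(Θ)`, over all `p̂_S`. -/
def linearMinimaxRisk (n m : ℕ) (Θ : Set (Fin n → ℝ)) : ℝ≥0∞ :=
  ⨅ s : Fin n → ℝ≥0, ⨆ θ ∈ Θ, klRisk m θ (linearDensity m s)

/-- The plug-in predictive density `p(y | θ̂(x))` of an estimator `θ̂`. -/
def plugInDensity {n : ℕ} (m : ℕ) (est : (Fin n → ℝ) → Fin n → ℝ) (x y : Fin n → ℝ) : ℝ≥0∞ :=
  gaussDensity (noise m) (est x) y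

/-- The minimax Kullback-Leibler risk over the class of plug-in predictive densities. -/
def plugInMinimaxRisk (n m : ℕ) (Θ : Set (Fin n → ℝ)) : ℝ≥0∞ :=
  ⨅ (est : (Fin n → ℝ) → Fin n → ℝ) (_ : Measurable est),
    ⨆ θ ∈ Θ, klRisk m θ (plugInDensity m est)

/-- The squared error risk `E ‖θ̂(X) - θ‖²` (Euclidean norm), where `X ~ N(θ, v_n I_n)`. -/
def sqRisk {n : ℕ} (θ : Fin n → ℝ) (est : (Fin n → ℝ) → Fin n → ℝ) : ℝ≥0∞ :=
  ∫⁻ x, ENNReal.ofReal (∑ i, (est x i - θ i) ^ 2) ∂(gaussLaw (noise n) θ)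

/-- The minimax squared error risk over all estimators. -/
def sqMinimaxRisk (n : ℕ) (Θ : Set (Fin n → ℝ)) : ℝ≥0∞ :=
  ⨅ (est : (Fin n → ℝ) → Fin n → ℝ) (_ : Measurable est), ⨆ θ ∈ Θ, sqRisk θ est

end

end PredDensity

/-!
The upper bounds come from linear rules under the prior `N(0, (C / n) I)`. By completing the square
the Bayes predictive density is `N(α X, (1 + α) / n I)` with `α = C / (1 + C)`, and its risk at `θ`
is an increasing affine function of `‖θ‖²` equal to `½ log (1 + α)` when `‖θ‖² = C`
(`linear_risk_eq`). The estimator `α X` likewise has squared error risk at most `α` on the ball.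

The lower bounds rest on `mul_gaussPrior_le_of_risk_le`. Let `q` be the Bayes predictive density
under `N(0, s I)` and `p̂` any competitor. The inequality `1 - 1 / t ≤ log t` gives, for each
parameter `θ` and observation `x`,
`1 + KL(P_θ, q_x) ≤ KL(P_θ, p̂_x) + ∫ (p̂_x / q_x) dP_θ` (`one_add_klDiv_le`). Averaged over `x` and
over `θ` in a set `A`, the last term is at most one, since over all `θ` it is exactly one
(`lintegral_ratio_eq_one`). Hence the worst unnormalised risk of `p̂` on `A` is, up to the additive
constant one, at least the risk of `q` on `A` times the prior mass of `A`. Unnormalised risks are of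
order `n`, so the constant is harmless. The prior `N(0, (a / n) I)` with `a` slightly below `C`
concentrates by Chebyshev's inequality on a thin shell inside the ball
(`one_sub_le_gaussPrior_shell`), and on that shell the risk of `q` is nearly `½ log (1 + α)`.

The same bound handles squared error. For a future vector of variance `1 / (ε n)` the divergence of
a plug-in density is `ε n / 2` times the squared error, while the bound for all predictive densities
is about `(n / 2) log (1 + ε α)`. Dividing and letting `ε → 0` gives `α`.
-/

namespace PredDensity

/-! ### Products of one-dimensional integrals and Gaussian densities -/

/-- Tonelli's theorem for a product of functions of the separate coordinates. -/
theorem lintegral_fin_prod_eq_prod {n : ℕ} (μ : Fin n → Measure ℝ) [∀ i, SigmaFinite (μ i)]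
    (f : Fin n → ℝ → ℝ≥0∞) (hf : ∀ i, Measurable (f i)) :
    ∫⁻ x, ∏ i, f i (x i) ∂(Measure.pi μ) = ∏ i, ∫⁻ t, f i t ∂(μ i) := by
  induction n with
  | zero => simp
  | succ n ih =>
    rw [← ((measurePreserving_piFinSuccAbove μ 0).symm).lintegral_comp_emb
      (MeasurableEquiv.measurableEmbedding _)]
    simp_rw [MeasurableEquiv.piFinSuccAbove_symm_apply, Fin.insertNthEquiv,
      Fin.prod_univ_succ, Fin.insertNth_zero]
    simp only [Equiv.coe_fn_mk, Fin.cons_zero, Fin.cons_succ, Fin.zero_succAbove]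
    rw [← ih (fun i => μ i.succ) (fun i => f i.succ) (fun i => hf _)]
    exact lintegral_prod_mul (μ := μ 0) (ν := Measure.pi fun i => μ (Fin.succ i))
      (hf 0).aemeasurable
      (g := fun x : Fin n → ℝ => ∏ i, f i.succ (x i))
      (Finset.measurable_prod _ fun i _ => (hf i.succ).comp (measurable_pi_apply i)).aemeasurable

instance {n : ℕ} (v : ℝ≥0) (θ : Fin n → ℝ) : IsProbabilityMeasure (gaussLaw v θ) := by
  unfold gaussLaw; infer_instance

instance {n : ℕ} (s : Fin n → ℝ≥0) : IsProbabilityMeasure (gaussPrior s) := by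
  unfold gaussPrior; infer_instance

@[fun_prop]
theorem measurable_gaussDensity {n : ℕ} {α : Type*} [MeasurableSpace α] (v : ℝ≥0)
    {f g : α → Fin n → ℝ} (hf : Measurable f) (hg : Measurable g) :
    Measurable fun a => gaussDensity v (f a) (g a) := by
  unfold gaussDensity
  refine Finset.measurable_prod _ fun i _ => ?_
  exact measurable_uncurry_gaussianPDF.comp
    (((measurable_pi_apply i).comp hf).prodMk
      (measurable_const.prodMk ((measurable_pi_apply i).comp hg)))

theorem gaussDensity_ne_zero {n : ℕ} {v : ℝ≥0} (hv : v ≠ 0) (θ x : Fin n → ℝ) :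
    gaussDensity v θ x ≠ 0 :=
  Finset.prod_ne_zero_iff.2 fun _ _ => (gaussianPDF_pos _ hv _).ne'

theorem gaussDensity_ne_top {n : ℕ} (v : ℝ≥0) (θ x : Fin n → ℝ) :
    gaussDensity v θ x ≠ ∞ :=
  ENNReal.prod_ne_top fun _ _ => gaussianPDF_ne_top

theorem lintegral_gaussDensity {n : ℕ} {v : ℝ≥0} (hv : v ≠ 0) (θ : Fin n → ℝ) :
    ∫⁻ x, gaussDensity v θ x = 1 := by
  unfold gaussDensity
  rw [volume_pi, lintegral_fin_prod_eq_prod _ (fun i => gaussianPDF (θ i) v)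
    (fun i => measurable_gaussianPDF _ _)]
  simp [hv]

theorem gaussLaw_eq_withDensity {n : ℕ} {v : ℝ≥0} (hv : v ≠ 0) (θ : Fin n → ℝ) :
    gaussLaw v θ = volume.withDensity (gaussDensity v θ) := by
  unfold gaussLaw
  refine Measure.pi_eq fun s hs => ?_
  rw [withDensity_apply _ (MeasurableSet.univ_pi hs), volume_pi, Measure.restrict_pi_pi]
  unfold gaussDensity
  rw [lintegral_fin_prod_eq_prod _ (fun i => gaussianPDF (θ i) v)
    (fun i => measurable_gaussianPDF _ _)]
  exact Finset.prod_congr rfl fun i _ => (gaussianReal_apply _ hv _).symm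

theorem lintegral_gaussLaw {n : ℕ} {v : ℝ≥0} (hv : v ≠ 0) (θ : Fin n → ℝ)
    {f : (Fin n → ℝ) → ℝ≥0∞} (hf : Measurable f) :
    ∫⁻ x, f x ∂(gaussLaw v θ) = ∫⁻ x, gaussDensity v θ x * f x := by
  rw [gaussLaw_eq_withDensity hv, lintegral_withDensity_eq_lintegral_mul _ (by fun_prop) hf]
  rfl

theorem IsPredictiveDensity.isProbabilityMeasure {n : ℕ} {p : (Fin n → ℝ) → (Fin n → ℝ) → ℝ≥0∞}
    (hp : IsPredictiveDensity p) (x : Fin n → ℝ) :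
    IsProbabilityMeasure (volume.withDensity (p x)) :=
  ⟨by rw [withDensity_apply _ .univ, Measure.restrict_univ, hp.lintegral_eq_one]⟩

theorem isPredictiveDensity_gaussDensity {n : ℕ} {w : ℝ≥0} (hw : w ≠ 0)
    {f : (Fin n → ℝ) → Fin n → ℝ} (hf : Measurable f) :
    IsPredictiveDensity fun x y => gaussDensity w (f x) y where
  measurable := by
    unfold Function.uncurry
    exact measurable_gaussDensity w (hf.comp measurable_fst) measurable_snd
  lintegral_eq_one x := lintegral_gaussDensity hw _

/-! ### Gaussian moments -/

theorem memLp_gaussianReal_sub (θ a : ℝ) (v : ℝ≥0) (p : ℝ≥0) :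
    MemLp (fun y : ℝ => y - a) p (gaussianReal θ v) :=
  (memLp_id_gaussianReal p).sub (memLp_const a)

theorem integrable_sub_sq_gaussianReal (θ a : ℝ) (v : ℝ≥0) :
    Integrable (fun y : ℝ => (y - a) ^ 2) (gaussianReal θ v) :=
  (memLp_gaussianReal_sub θ a v 2).integrable_sq

theorem integral_sub_sq_gaussianReal (θ a : ℝ) (v : ℝ≥0) :
    ∫ y, (y - a) ^ 2 ∂(gaussianReal θ v) = v + (θ - a) ^ 2 := by
  have hvar : ∫ y, (y - θ) ^ 2 ∂(gaussianReal θ v) = v := by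
    have h := variance_fun_id_gaussianReal (μ := θ) (v := v)
    rw [variance_eq_integral (by fun_prop)] at h
    simpa only [integral_id_gaussianReal] using h
  have hint : Integrable (fun y : ℝ => y) (gaussianReal θ v) :=
    (memLp_id_gaussianReal 1).integrable (by simp)
  have hexp : (fun y : ℝ => (y - a) ^ 2) =
      fun y => (y - θ) ^ 2 + (2 * (θ - a) * y + (a ^ 2 - θ ^ 2)) := by
    funext y; ring
  have hlin : Integrable (fun y : ℝ => 2 * (θ - a) * y + (a ^ 2 - θ ^ 2)) (gaussianReal θ v) :=
    (hint.const_mul _).add (integrable_const _)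
  rw [hexp, integral_add (integrable_sub_sq_gaussianReal θ θ v) hlin,
    integral_add (hint.const_mul _) (integrable_const _), integral_const_mul, hvar,
    integral_id_gaussianReal]
  simp; ring

theorem integrable_linear_sub_sq_gaussianReal (θ t c : ℝ) (v : ℝ≥0) :
    Integrable (fun y : ℝ => (c * y - t) ^ 2) (gaussianReal θ v) :=
  (((memLp_id_gaussianReal 2).const_mul c).sub (memLp_const t)).integrable_sq

theorem integral_linear_sub_sq_gaussianReal (θ c : ℝ) (v : ℝ≥0) :
    ∫ y, (c * y - θ) ^ 2 ∂(gaussianReal θ v) = c ^ 2 * v + (1 - c) ^ 2 * θ ^ 2 := by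
  rcases eq_or_ne c 0 with rfl | hc
  · simp
  have h : ∀ y : ℝ, (c * y - θ) ^ 2 = c ^ 2 * (y - θ / c) ^ 2 := by
    intro y; field_simp
  simp_rw [h]
  rw [integral_const_mul, integral_sub_sq_gaussianReal]
  field_simp
  ring

/-- The mean of a quadratic loss of the linear estimator `c X` of `θ`, split into variance and
squared bias. -/
theorem lintegral_linear_sub_sq_gaussLaw {n : ℕ} (v : ℝ≥0) (θ : Fin n → ℝ) {a b : ℝ} (c : ℝ)
    (ha : 0 ≤ a) (hb : 0 ≤ b) :
    ∫⁻ x, ENNReal.ofReal (∑ i, (a + b * (c * x i - θ i) ^ 2)) ∂(gaussLaw v θ) =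
      ENNReal.ofReal (n * a + b * (n * (c ^ 2 * v) + (1 - c) ^ 2 * ∑ i, θ i ^ 2)) := by
  have hI : ∀ i, Integrable (fun y : ℝ => a + b * (c * y - θ i) ^ 2) (gaussianReal (θ i) v) :=
    fun i => (integrable_const _).add ((integrable_linear_sub_sq_gaussianReal _ _ _ _).const_mul _)
  have hI' : ∀ i, Integrable (fun x : Fin n → ℝ => a + b * (c * x i - θ i) ^ 2)
      (gaussLaw v θ) := fun i =>
    integrable_comp_eval (μ := fun i => gaussianReal (θ i) v)
      (f := fun y : ℝ => a + b * (c * y - θ i) ^ 2) (hI i)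
  rw [← ofReal_integral_eq_lintegral_ofReal (integrable_finsetSum _ fun i _ => hI' i)
    (ae_of_all _ fun x => Finset.sum_nonneg fun i _ => by positivity),
    integral_finsetSum _ fun i _ => hI' i]
  congr 1
  have h : ∀ i, ∫ x : Fin n → ℝ, (a + b * (c * x i - θ i) ^ 2) ∂(gaussLaw v θ) =
      a + b * (c ^ 2 * v + (1 - c) ^ 2 * θ i ^ 2) := by
    intro i
    unfold gaussLaw
    rw [integral_comp_eval (μ := fun i => gaussianReal (θ i) v)
      (f := fun y : ℝ => a + b * (c * y - θ i) ^ 2) (hI i).aestronglyMeasurable,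
      integral_add (integrable_const _)
        ((integrable_linear_sub_sq_gaussianReal _ _ _ _).const_mul _),
      integral_const_mul, integral_linear_sub_sq_gaussianReal]
    simp
  simp_rw [h]
  simp only [mul_add, Finset.sum_add_distrib, Finset.sum_const, Finset.card_univ,
    Fintype.card_fin, nsmul_eq_mul, Finset.mul_sum]
  ring

/-! ### Kullback-Leibler divergence of measures with densities -/

/-- For probability measures with densities `p` and `q`, the first absolutely continuous with
respect to the second, the log-likelihood ratio is almost everywhere `log p - log q`, and both
densities are almost everywhere positive and finite. -/
theorem ae_llr_withDensity {α : Type*} [MeasurableSpace α] {μ : Measure α} [SigmaFinite μ]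
    {p q : α → ℝ≥0∞} (hp : Measurable p) (hq : Measurable q)
    [IsProbabilityMeasure (μ.withDensity p)] [IsProbabilityMeasure (μ.withDensity q)]
    (hpq : μ.withDensity p ≪ μ.withDensity q) :
    ∀ᵐ x ∂(μ.withDensity p), (p x ≠ 0 ∧ p x ≠ ∞) ∧ (q x ≠ 0 ∧ q x ≠ ∞) ∧
      llr (μ.withDensity p) (μ.withDensity q) x =
        Real.log (p x).toReal - Real.log (q x).toReal := by
  have key : ∀ r : α → ℝ≥0∞, Measurable r → IsProbabilityMeasure (μ.withDensity r) →
      ∀ᵐ x ∂(μ.withDensity r), r x ≠ 0 ∧ r x ≠ ∞ := by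
    intro r hr hP
    have h1 : ∀ᵐ x ∂μ, r x < ∞ := by
      refine ae_lt_top hr ?_
      have := hP.measure_univ
      rw [withDensity_apply _ .univ, Measure.restrict_univ] at this
      simp [this]
    rw [ae_withDensity_iff hr]
    filter_upwards [h1] with x hx h0 using ⟨h0, hx.ne⟩
  have hP := withDensity_absolutelyContinuous μ p
  have hQ := withDensity_absolutelyContinuous μ q
  filter_upwards [key p hp inferInstance, hpq.ae_le (key q hq inferInstance),
    hpq.ae_le (Measure.rnDeriv_eq_div hP hQ), hP.ae_le (Measure.rnDeriv_withDensity μ hp),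
    hP.ae_le (Measure.rnDeriv_withDensity μ hq)] with x h1 h2 h3 h4 h5
  refine ⟨h1, h2, ?_⟩
  simp only [llr_def]
  rw [h3, h4, h5, ENNReal.toReal_div,
    Real.log_div (ENNReal.toReal_ne_zero.2 h1) (ENNReal.toReal_ne_zero.2 h2)]

/-- A one-sided comparison of divergences, from `1 - 1/t ≤ log t` with `t = q / r`. After averaging
over the data and over a prior for which `q` is the Bayes predictive density, the ratio term has
total mass at most one. -/
theorem one_add_klDiv_le {α : Type*} [MeasurableSpace α] {μ : Measure α} [SigmaFinite μ]
    {p q r : α → ℝ≥0∞} (hp : Measurable p) (hq : Measurable q) (hr : Measurable r)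
    [IsProbabilityMeasure (μ.withDensity p)] [IsProbabilityMeasure (μ.withDensity q)]
    [IsProbabilityMeasure (μ.withDensity r)]
    (hpq : μ.withDensity p ≪ μ.withDensity q)
    (hint : Integrable (llr (μ.withDensity p) (μ.withDensity q)) (μ.withDensity p)) :
    1 + klDiv (μ.withDensity p) (μ.withDensity q) ≤
      klDiv (μ.withDensity p) (μ.withDensity r) + ∫⁻ x, r x / q x ∂(μ.withDensity p) := by
  by_cases hL : ∫⁻ x, r x / q x ∂(μ.withDensity p) = ∞
  · simp [hL]
  by_cases hK : klDiv (μ.withDensity p) (μ.withDensity r) = ∞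
  · simp [hK]
  obtain ⟨hpr, hintr⟩ := klDiv_ne_top_iff.1 hK
  have hintL : Integrable (fun x => (r x / q x).toReal) (μ.withDensity p) :=
    integrable_toReal_of_lintegral_ne_top (hr.div hq).aemeasurable hL
  have hLr : ∫⁻ x, r x / q x ∂(μ.withDensity p) =
      ENNReal.ofReal (∫ x, (r x / q x).toReal ∂(μ.withDensity p)) := by
    rw [integral_toReal (f := fun x => r x / q x) (hr.div hq).aemeasurable
      (ae_lt_top (hr.div hq) hL), ENNReal.ofReal_toReal hL]
  have hle : ∫ x, (1 + llr (μ.withDensity p) (μ.withDensity q) x) ∂(μ.withDensity p) ≤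
      ∫ x, (llr (μ.withDensity p) (μ.withDensity r) x + (r x / q x).toReal)
        ∂(μ.withDensity p) := by
    refine integral_mono_ae ((integrable_const _).add hint) (hintr.add hintL) ?_
    filter_upwards [ae_llr_withDensity hp hq hpq, ae_llr_withDensity hp hr hpr] with x h1 h2
    have hqx : 0 < (q x).toReal := ENNReal.toReal_pos h1.2.1.1 h1.2.1.2
    have hrx : 0 < (r x).toReal := ENNReal.toReal_pos h2.2.1.1 h2.2.1.2
    have h := Real.one_sub_inv_le_log_of_pos (div_pos hqx hrx)
    rw [Real.log_div hqx.ne' hrx.ne', inv_div] at h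
    rw [h1.2.2, h2.2.2, ENNReal.toReal_div]
    linarith
  rw [integral_add (integrable_const _) hint, integral_add hintr hintL] at hle
  have e1 := toReal_klDiv_of_measure_eq hpq (by simp)
  have e2 := toReal_klDiv_of_measure_eq hpr (by simp)
  rw [← e1, ← e2] at hle
  rw [hLr, ← ENNReal.ofReal_toReal hK, ← ENNReal.ofReal_toReal (klDiv_ne_top hpq hint),
    ← ENNReal.ofReal_one, ← ENNReal.ofReal_add zero_le_one ENNReal.toReal_nonneg,
    ← ENNReal.ofReal_add ENNReal.toReal_nonneg (integral_nonneg fun _ => ENNReal.toReal_nonneg)]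
  refine ENNReal.ofReal_le_ofReal ?_
  simpa using hle

/-! ### Divergence between two Gaussian laws -/

theorem log_gaussianPDFReal (θ y : ℝ) {w : ℝ≥0} (hw : w ≠ 0) :
    Real.log (gaussianPDFReal θ w y) =
      -(1 / 2 * (Real.log (2 * Real.pi) + Real.log w)) - (y - θ) ^ 2 / (2 * w) := by
  have hw' : (0 : ℝ) < w := by positivity
  rw [gaussianPDFReal, Real.log_mul (by positivity) (by positivity), Real.log_exp, Real.log_inv,
    Real.log_sqrt (by positivity), Real.log_mul (by positivity) hw'.ne']
  ring

theorem log_gaussDensity {n : ℕ} (θ y : Fin n → ℝ) {w : ℝ≥0} (hw : w ≠ 0) :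
    Real.log (gaussDensity w θ y).toReal =
      ∑ i, (-(1 / 2 * (Real.log (2 * Real.pi) + Real.log w)) - (y i - θ i) ^ 2 / (2 * w)) := by
  rw [gaussDensity, ENNReal.toReal_prod, Real.log_prod]
  · exact Finset.sum_congr rfl fun i _ => by rw [toReal_gaussianPDF, log_gaussianPDFReal _ _ hw]
  · intro i _
    rw [toReal_gaussianPDF]
    exact (gaussianPDFReal_pos _ _ _ hw).ne'

theorem withDensity_gaussDensity_absolutelyContinuous {n : ℕ} {u : ℝ≥0} (hu : u ≠ 0)
    (w : ℝ≥0) (θ μ : Fin n → ℝ) :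
    (volume.withDensity (gaussDensity w θ)) ≪ volume.withDensity (gaussDensity u μ) :=
  (withDensity_absolutelyContinuous _ _).trans
    (withDensity_absolutelyContinuous' (by fun_prop)
      (ae_of_all _ fun x => gaussDensity_ne_zero hu _ _))

theorem isProbabilityMeasure_withDensity_gaussDensity {n : ℕ} {v : ℝ≥0} (hv : v ≠ 0)
    (θ : Fin n → ℝ) : IsProbabilityMeasure (volume.withDensity (gaussDensity v θ)) := by
  rw [← gaussLaw_eq_withDensity hv]; infer_instance

/-- The divergence from `N(θ, w I)` to `N(μ, u I)`, with the integrability of the log-likelihood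
ratio. -/
theorem klDiv_gaussDensity {n : ℕ} {w u : ℝ≥0} (hw : w ≠ 0) (hu : u ≠ 0) (θ μ : Fin n → ℝ) :
    Integrable (llr (volume.withDensity (gaussDensity w θ)) (volume.withDensity (gaussDensity u μ)))
      (volume.withDensity (gaussDensity w θ)) ∧
    klDiv (volume.withDensity (gaussDensity w θ)) (volume.withDensity (gaussDensity u μ)) =
      ENNReal.ofReal (∑ i, (1 / 2 * (Real.log (u / w) + w / u - 1) +
        1 / (2 * u) * (μ i - θ i) ^ 2)) := by
  have := isProbabilityMeasure_withDensity_gaussDensity hw θ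
  have := isProbabilityMeasure_withDensity_gaussDensity hu μ
  have hac := withDensity_gaussDensity_absolutelyContinuous hu w θ μ
  have hw' : (0 : ℝ) < w := by positivity
  have hu' : (0 : ℝ) < u := by positivity
  let h : Fin n → ℝ → ℝ := fun i t =>
    1 / 2 * Real.log (u / w) + (1 / (2 * u) * (t - μ i) ^ 2 - 1 / (2 * w) * (t - θ i) ^ 2)
  have hllr : llr (volume.withDensity (gaussDensity w θ)) (volume.withDensity (gaussDensity u μ))
      =ᵐ[volume.withDensity (gaussDensity w θ)] fun y => ∑ i, h i (y i) := by
    filter_upwards [ae_llr_withDensity (by fun_prop) (by fun_prop) hac] with y hy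
    rw [hy.2.2, log_gaussDensity _ _ hw, log_gaussDensity _ _ hu, ← Finset.sum_sub_distrib]
    refine Finset.sum_congr rfl fun i _ => ?_
    simp only [h]
    rw [Real.log_div hu'.ne' hw'.ne']
    ring
  have hA : ∀ i, Integrable (fun t : ℝ => 1 / (2 * (u : ℝ)) * (t - μ i) ^ 2)
      (gaussianReal (θ i) w) := fun i => (integrable_sub_sq_gaussianReal _ _ _).const_mul _
  have hB : ∀ i, Integrable (fun t : ℝ => 1 / (2 * (w : ℝ)) * (t - θ i) ^ 2)
      (gaussianReal (θ i) w) := fun i => (integrable_sub_sq_gaussianReal _ _ _).const_mul _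
  have hAB : ∀ i, Integrable (fun t : ℝ => 1 / (2 * (u : ℝ)) * (t - μ i) ^ 2 -
      1 / (2 * (w : ℝ)) * (t - θ i) ^ 2) (gaussianReal (θ i) w) := fun i => (hA i).sub (hB i)
  have hI : ∀ i, Integrable (h i) (gaussianReal (θ i) w) :=
    fun i => (integrable_const _).add (hAB i)
  have hI' : ∀ i, Integrable (fun y : Fin n → ℝ => h i (y i))
      (volume.withDensity (gaussDensity w θ)) := by
    intro i
    rw [← gaussLaw_eq_withDensity hw]
    exact integrable_comp_eval (μ := fun i => gaussianReal (θ i) w) (hI i)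
  have hint := (integrable_congr hllr).2 (integrable_finsetSum Finset.univ fun i _ => hI' i)
  refine ⟨hint, ?_⟩
  rw [klDiv_of_ac_of_integrable hac hint, integral_congr_ae hllr,
    integral_finsetSum _ fun i _ => hI' i]
  congr 1
  rw [probReal_univ, probReal_univ, add_sub_cancel_right]
  refine Finset.sum_congr rfl fun i _ => ?_
  rw [← gaussLaw_eq_withDensity hw, gaussLaw,
    integral_comp_eval (μ := fun i => gaussianReal (θ i) w) (hI i).aestronglyMeasurable]
  simp only [h]
  rw [integral_add (integrable_const _) (hAB i), integral_sub (hA i) (hB i)]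
  simp only [integral_const_mul, integral_sub_sq_gaussianReal]
  simp
  field_simp
  ring

/-- The mean divergence from `N(θ, w I)` to `N(c X, u I)` when `X ~ N(θ, v I)`. -/
theorem lintegral_klDiv_linear {n : ℕ} {v w u : ℝ≥0} (hw : w ≠ 0) (hu : u ≠ 0) (c : ℝ)
    (θ : Fin n → ℝ) :
    ∫⁻ x, klDiv (gaussLaw w θ) (volume.withDensity (gaussDensity u fun i => c * x i))
      ∂(gaussLaw v θ) =
    ENNReal.ofReal (n * (1 / 2 * (Real.log (u / w) + w / u - 1)) +
      1 / (2 * u) * (n * (c ^ 2 * v) + (1 - c) ^ 2 * ∑ i, θ i ^ 2)) := by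
  have hw' : (0 : ℝ) < w := by positivity
  have hu' : (0 : ℝ) < u := by positivity
  have h := Real.one_sub_inv_le_log_of_pos (div_pos hu' hw')
  rw [inv_div] at h
  rw [← lintegral_linear_sub_sq_gaussLaw v θ c (by linarith) (by positivity)]
  refine lintegral_congr fun x => ?_
  rw [gaussLaw_eq_withDensity hw, (klDiv_gaussDensity hw hu _ _).2]

/-! ### Bayes predictive densities under Gaussian priors -/

/-- Completing the square: a Gaussian prior density times a Gaussian likelihood is the marginal
density of the observation times the posterior density. -/
theorem gaussianPDF_mul_gaussianPDF {s v : ℝ≥0} (hs : s ≠ 0) (hv : v ≠ 0) (m t x : ℝ) :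
    gaussianPDF m s t * gaussianPDF t v x =
      gaussianPDF m (s + v) x *
        gaussianPDF ((s * x + v * m) / (s + v)) (s * v / (s + v)) t := by
  have hs' : (0 : ℝ) < s := by positivity
  have hv' : (0 : ℝ) < v := by positivity
  simp only [gaussianPDF]
  rw [← ENNReal.ofReal_mul (gaussianPDFReal_nonneg _ _ _),
    ← ENNReal.ofReal_mul (gaussianPDFReal_nonneg _ _ _)]
  congr 1
  simp only [gaussianPDFReal, NNReal.coe_add, NNReal.coe_div, NNReal.coe_mul]
  rw [mul_mul_mul_comm (√(2 * Real.pi * s))⁻¹, mul_mul_mul_comm (√(2 * Real.pi * (s + v)))⁻¹,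
    ← mul_inv, ← mul_inv, ← Real.exp_add, ← Real.exp_add,
    ← Real.sqrt_mul (by positivity), ← Real.sqrt_mul (by positivity)]
  congr 2
  · congr 1
    field_simp
  · field_simp
    ring

theorem measurable_gaussianPDF_mean (v : ℝ≥0) (x : ℝ) : Measurable fun t => gaussianPDF t v x := by
  unfold gaussianPDF gaussianPDFReal
  fun_prop

theorem lintegral_gaussianPDF_gaussianReal {s v : ℝ≥0} (hs : s ≠ 0) (hv : v ≠ 0) (x : ℝ) :
    ∫⁻ t, gaussianPDF t v x ∂(gaussianReal 0 s) = gaussianPDF 0 (s + v) x := by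
  have hτ : s * v / (s + v) ≠ 0 := by positivity
  rw [gaussianReal_of_var_ne_zero _ hs,
    lintegral_withDensity_eq_lintegral_mul _ (measurable_gaussianPDF _ _)
      (measurable_gaussianPDF_mean v x)]
  simp only [Pi.mul_apply, gaussianPDF_mul_gaussianPDF hs hv]
  rw [lintegral_const_mul _ (measurable_gaussianPDF _ _), lintegral_gaussianPDF_eq_one _ hτ,
    mul_one]

theorem lintegral_gaussianPDF_mul_gaussianReal {s v w : ℝ≥0} (hs : s ≠ 0) (hv : v ≠ 0)
    (hw : w ≠ 0) (x y : ℝ) :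
    ∫⁻ t, gaussianPDF t v x * gaussianPDF t w y ∂(gaussianReal 0 s) =
      gaussianPDF 0 (s + v) x * gaussianPDF (s / (s + v) * x) (s * v / (s + v) + w) y := by
  have hτ : s * v / (s + v) ≠ 0 := by positivity
  have hτ' : s * v / (s + v) * w / (s * v / (s + v) + w) ≠ 0 := by positivity
  rw [gaussianReal_of_var_ne_zero _ hs,
    lintegral_withDensity_eq_lintegral_mul _ (measurable_gaussianPDF _ _)
      (f := fun t => gaussianPDF 0 s t)
      (g := fun t => gaussianPDF t v x * gaussianPDF t w y)
      ((measurable_gaussianPDF_mean v x).mul (measurable_gaussianPDF_mean w y))]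
  simp only [Pi.mul_apply, ← mul_assoc]
  simp only [gaussianPDF_mul_gaussianPDF hs hv]
  simp only [mul_assoc, gaussianPDF_mul_gaussianPDF hτ hw]
  rw [lintegral_const_mul _ ((measurable_gaussianPDF _ _).const_mul _),
    lintegral_const_mul _ (measurable_gaussianPDF _ _), lintegral_gaussianPDF_eq_one _ hτ',
    mul_one, mul_zero, add_zero, mul_div_right_comm]

theorem lintegral_gaussDensity_gaussPrior {n : ℕ} {s v : ℝ≥0} (hs : s ≠ 0) (hv : v ≠ 0)
    (x : Fin n → ℝ) :
    ∫⁻ θ, gaussDensity v θ x ∂(gaussPrior fun _ : Fin n => s) = gaussDensity (s + v) 0 x := by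
  simp only [gaussDensity, gaussPrior]
  rw [lintegral_fin_prod_eq_prod _ (fun i t => gaussianPDF t v (x i)) fun i =>
    measurable_gaussianPDF_mean _ _]
  exact Finset.prod_congr rfl fun i _ => lintegral_gaussianPDF_gaussianReal hs hv _

/-- The joint density of the observation and the future vector under the prior `N(0, s I)`, as the
marginal density of the former times the Bayes predictive density. -/
theorem lintegral_gaussDensity_mul_gaussPrior {n : ℕ} {s v w : ℝ≥0} (hs : s ≠ 0) (hv : v ≠ 0)
    (hw : w ≠ 0) (x y : Fin n → ℝ) :
    ∫⁻ θ, gaussDensity v θ x * gaussDensity w θ y ∂(gaussPrior fun _ : Fin n => s) =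
      gaussDensity (s + v) 0 x *
        gaussDensity (s * v / (s + v) + w) (fun i => (s / (s + v) : ℝ) * x i) y := by
  simp only [gaussDensity, gaussPrior, ← Finset.prod_mul_distrib]
  rw [lintegral_fin_prod_eq_prod _
    (fun i t => gaussianPDF t v (x i) * gaussianPDF t w (y i)) fun i => 
      (measurable_gaussianPDF_mean _ _).mul (measurable_gaussianPDF_mean _ _)]
  exact Finset.prod_congr rfl fun i _ => lintegral_gaussianPDF_mul_gaussianReal hs hv hw _ _

theorem noise_ne_zero {n : ℕ} (hn : 1 ≤ n) : noise n ≠ 0 := by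
  unfold noise
  have : n ≠ 0 := by omega
  positivity

theorem linearDensity_const {n m : ℕ} (hn : 1 ≤ n) (hm : 1 ≤ m) {s : ℝ≥0} (hs : s ≠ 0)
    (x y : Fin n → ℝ) :
    linearDensity m (fun _ => s) x y =
      gaussDensity (s * noise n / (s + noise n) + noise m)
        (fun i => (s / (s + noise n) : ℝ) * x i) y := by
  unfold linearDensity
  rw [lintegral_gaussDensity_mul_gaussPrior hs (noise_ne_zero hn) (noise_ne_zero hm),
    lintegral_gaussDensity_gaussPrior hs (noise_ne_zero hn), mul_comm,
    ENNReal.mul_div_cancel_right (gaussDensity_ne_zero (by positivity) _ _)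
      (gaussDensity_ne_top _ _ _)]

theorem gaussDensity_le {n : ℕ} (v : ℝ≥0) (θ x : Fin n → ℝ) :
    gaussDensity v θ x ≤ ∏ _i : Fin n, ENNReal.ofReal (√(2 * Real.pi * v))⁻¹ := by
  unfold gaussDensity
  refine Finset.prod_le_prod' fun i _ => ?_
  refine ENNReal.ofReal_le_ofReal ?_
  rw [gaussianPDFReal]
  refine mul_le_of_le_one_right (by positivity) (Real.exp_le_one_iff.2 ?_)
  rw [neg_div]
  exact neg_nonpos.2 (by positivity)

theorem isPredictiveDensity_linearDensity {n m : ℕ} (hn : 1 ≤ n) (hm : 1 ≤ m)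
    (s : Fin n → ℝ≥0) : IsPredictiveDensity (linearDensity m s) where
  measurable := by
    unfold Function.uncurry linearDensity
    refine Measurable.div ?_ ?_
    · exact Measurable.lintegral_prod_right'
        (f := fun z : ((Fin n → ℝ) × (Fin n → ℝ)) × (Fin n → ℝ) =>
          gaussDensity (noise n) z.2 z.1.1 * gaussDensity (noise m) z.2 z.1.2) (by fun_prop)
    · exact Measurable.lintegral_prod_right'
        (f := fun z : ((Fin n → ℝ) × (Fin n → ℝ)) × (Fin n → ℝ) =>
          gaussDensity (noise n) z.2 z.1.1) (by fun_prop)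
  lintegral_eq_one x := by
    have hpos : ∫⁻ θ, gaussDensity (noise n) θ x ∂(gaussPrior s) ≠ 0 := by
      rw [Ne, lintegral_eq_zero_iff (by fun_prop)]
      intro h
      obtain ⟨θ, hθ⟩ := h.exists
      exact gaussDensity_ne_zero (noise_ne_zero hn) _ _ hθ
    have htop : ∫⁻ θ, gaussDensity (noise n) θ x ∂(gaussPrior s) ≠ ∞ := by
      refine ne_top_of_le_ne_top ?_ (lintegral_mono fun θ => gaussDensity_le (noise n) θ x)
      rw [lintegral_const, measure_univ, mul_one]
      exact ENNReal.prod_ne_top fun _ _ => ENNReal.ofReal_ne_top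
    unfold linearDensity
    simp_rw [div_eq_mul_inv]
    rw [lintegral_mul_const', lintegral_lintegral_swap (by fun_prop)]
    · have h : ∀ θ : Fin n → ℝ, ∫⁻ y, gaussDensity (noise n) θ x * gaussDensity (noise m) θ y =
          gaussDensity (noise n) θ x := fun θ => by
        rw [lintegral_const_mul _ (by fun_prop), lintegral_gaussDensity (noise_ne_zero hm), mul_one]
      simp_rw [h]
      exact ENNReal.mul_inv_cancel hpos htop
    · exact ENNReal.inv_ne_top.2 hpos

/-! ### The Bayes lower bound -/

/-- If `q` is the Bayes predictive density under the prior `N(0, s I)`, then `p̂ / q` has mean one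
under the joint law of parameter, observation and future vector. -/
theorem lintegral_ratio_eq_one {n : ℕ} {s v w : ℝ≥0} (hs : s ≠ 0) (hv : v ≠ 0)
    (hw : w ≠ 0) {p q : (Fin n → ℝ) → (Fin n → ℝ) → ℝ≥0∞} (hp : IsPredictiveDensity p)
    (hq : q = fun x y => gaussDensity (s * v / (s + v) + w) (fun i => (s / (s + v) : ℝ) * x i) y)
    (hr : Measurable fun z : (Fin n → ℝ) × (Fin n → ℝ) => p z.1 z.2 / q z.1 z.2)
    (hGm : Measurable fun z : (Fin n → ℝ) × (Fin n → ℝ) =>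
      gaussDensity v z.1 z.2 * ∫⁻ y, gaussDensity w z.1 y * (p z.2 y / q z.2 y)) :
    ∫⁻ θ, (∫⁻ x, gaussDensity v θ x * ∫⁻ y, gaussDensity w θ y * (p x y / q x y))
      ∂(gaussPrior fun _ : Fin n => s) = 1 := by
  rw [lintegral_lintegral_swap hGm.aemeasurable]
  have hx : ∀ x, ∫⁻ θ, (gaussDensity v θ x * ∫⁻ y, gaussDensity w θ y * (p x y / q x y))
      ∂(gaussPrior fun _ : Fin n => s) = gaussDensity (s + v) 0 x := by
    intro x
    have hrx : Measurable fun y => p x y / q x y := hr.comp measurable_prodMk_left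
    have hstep : ∀ θ, gaussDensity v θ x * ∫⁻ y, gaussDensity w θ y * (p x y / q x y) =
        ∫⁻ y, gaussDensity v θ x * gaussDensity w θ y * (p x y / q x y) := by
      intro θ
      rw [← lintegral_const_mul' _ _ (gaussDensity_ne_top _ _ _)]
      simp_rw [mul_assoc]
    simp_rw [hstep]
    rw [lintegral_lintegral_swap
      (Measurable.mul (by fun_prop) (hrx.comp measurable_snd)).aemeasurable]
    have hy : ∀ y, ∫⁻ θ, gaussDensity v θ x * gaussDensity w θ y * (p x y / q x y)
        ∂(gaussPrior fun _ : Fin n => s) = gaussDensity (s + v) 0 x * p x y := by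
      intro y
      rw [lintegral_mul_const _ (by fun_prop), lintegral_gaussDensity_mul_gaussPrior hs hv hw,
        mul_assoc, hq]
      congr 1
      exact ENNReal.mul_div_cancel (gaussDensity_ne_zero (by positivity) _ _)
        (gaussDensity_ne_top _ _ _)
    simp_rw [hy]
    rw [lintegral_const_mul' _ _ (gaussDensity_ne_top _ _ _), hp.lintegral_eq_one, mul_one]
  simp_rw [hx]
  exact lintegral_gaussDensity (by positivity) _

/-- A lower bound for the worst risk of a predictive density over a set `A` of parameters. If the
Bayes predictive density under the prior `π = N(0, s I)` has unnormalised risk at least `k` on `A`,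
then any predictive density whose unnormalised risk on `A` is at most `M` satisfies
`k π(A) ≤ M + 1`. The additive constant pays for cutting the prior down to `A`, and is negligible
because the unnormalised risks grow with the dimension. -/
theorem mul_gaussPrior_le_of_risk_le {n : ℕ} {s v w : ℝ≥0} (hs : s ≠ 0) (hv : v ≠ 0)
    (hw : w ≠ 0) {p : (Fin n → ℝ) → (Fin n → ℝ) → ℝ≥0∞} (hp : IsPredictiveDensity p)
    {A : Set (Fin n → ℝ)} (hA : MeasurableSet A) {M k : ℝ≥0∞}
    (hM : ∀ θ ∈ A, ∫⁻ x, klDiv (gaussLaw w θ) (volume.withDensity (p x)) ∂(gaussLaw v θ) ≤ M)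
    (hk : ∀ θ ∈ A, k ≤ ∫⁻ x, klDiv (gaussLaw w θ) (volume.withDensity
      (gaussDensity (s * v / (s + v) + w) fun i => (s / (s + v) : ℝ) * x i)) ∂(gaussLaw v θ)) :
    k * gaussPrior (fun _ : Fin n => s) A ≤ M + 1 := by
  obtain ⟨q, hqdef⟩ : ∃ q : (Fin n → ℝ) → (Fin n → ℝ) → ℝ≥0∞, q = fun x y =>
    gaussDensity (s * v / (s + v) + w) (fun i => (s / (s + v) : ℝ) * x i) y := ⟨_, rfl⟩
  have hqx : ∀ x, q x = gaussDensity (s * v / (s + v) + w) fun i => (s / (s + v) : ℝ) * x i :=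
    fun x => by rw [hqdef]
  have hu : s * v / (s + v) + w ≠ 0 := by positivity
  simp_rw [← hqx] at hk
  set π := gaussPrior (fun _ : Fin n => s)
  have hq : Measurable (Function.uncurry q) := by
    rw [hqdef]
    unfold Function.uncurry
    fun_prop
  have hpm := hp.measurable
  have hr : Measurable fun z : (Fin n → ℝ) × (Fin n → ℝ) => p z.1 z.2 / q z.1 z.2 := hpm.div hq
  obtain ⟨L, hLdef⟩ : ∃ L : (Fin n → ℝ) → (Fin n → ℝ) → ℝ≥0∞, L = fun θ x =>
    ∫⁻ y, gaussDensity w θ y * (p x y / q x y) := ⟨_, rfl⟩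
  have hLm : Measurable fun z : (Fin n → ℝ) × (Fin n → ℝ) => L z.1 z.2 := by
    have h1 : Measurable fun z : ((Fin n → ℝ) × (Fin n → ℝ)) × (Fin n → ℝ) => (z.1.2, z.2) := by
      fun_prop
    have h2 : Measurable fun z : ((Fin n → ℝ) × (Fin n → ℝ)) × (Fin n → ℝ) =>
        gaussDensity w z.1.1 z.2 := by fun_prop
    rw [hLdef]
    exact (h2.mul (hr.comp h1)).lintegral_prod_right'
  have hLx : ∀ θ, Measurable (L θ) := fun θ => hLm.comp measurable_prodMk_left
  have hpoint : ∀ θ x, 1 + klDiv (gaussLaw w θ) (volume.withDensity (q x)) ≤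
      klDiv (gaussLaw w θ) (volume.withDensity (p x)) + L θ x := by
    intro θ x
    have := isProbabilityMeasure_withDensity_gaussDensity hw θ
    have : IsProbabilityMeasure (volume.withDensity (q x)) := by
      rw [hqx]; exact isProbabilityMeasure_withDensity_gaussDensity hu _
    have := hp.isProbabilityMeasure x
    have h := one_add_klDiv_le (μ := volume) (p := gaussDensity w θ) (q := q x) (r := p x)
      (by fun_prop) (hq.comp measurable_prodMk_left) (hpm.comp measurable_prodMk_left)
      (by rw [hqx]; exact withDensity_gaussDensity_absolutelyContinuous hu w θ _)
      (by rw [hqx]; exact (klDiv_gaussDensity hw hu _ _).1)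
    rw [← gaussLaw_eq_withDensity hw, lintegral_gaussLaw hw] at h
    · rw [hLdef]; exact h
    · exact hr.comp measurable_prodMk_left
  have hθ : ∀ θ ∈ A, 1 + k ≤ M + ∫⁻ x, gaussDensity v θ x * L θ x := by
    intro θ hθA
    rw [← lintegral_gaussLaw hv θ (hLx θ)]
    calc 1 + k ≤ 1 + ∫⁻ x, klDiv (gaussLaw w θ) (volume.withDensity (q x)) ∂(gaussLaw v θ) := by
          gcongr; exact hk θ hθA
      _ = ∫⁻ x, (1 + klDiv (gaussLaw w θ) (volume.withDensity (q x))) ∂(gaussLaw v θ) := by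
          rw [lintegral_add_left measurable_const]; simp
      _ ≤ ∫⁻ x, (klDiv (gaussLaw w θ) (volume.withDensity (p x)) + L θ x) ∂(gaussLaw v θ) :=
          lintegral_mono fun x => hpoint θ x
      _ = ∫⁻ x, klDiv (gaussLaw w θ) (volume.withDensity (p x)) ∂(gaussLaw v θ) +
            ∫⁻ x, L θ x ∂(gaussLaw v θ) := lintegral_add_right _ (hLx θ)
      _ ≤ _ := by gcongr; exact hM θ hθA
  have hGm : Measurable fun z : (Fin n → ℝ) × (Fin n → ℝ) => gaussDensity v z.1 z.2 * L z.1 z.2 :=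
    Measurable.mul (by fun_prop) hLm
  have hone : ∫⁻ θ, (∫⁻ x, gaussDensity v θ x * L θ x) ∂π = 1 := by
    subst hLdef
    exact lintegral_ratio_eq_one hs hv hw hp hqdef hr hGm
  have hfin : (1 + k) * π A ≤ M * π A + 1 := by
    calc (1 + k) * π A = ∫⁻ _ in A, (1 + k) ∂π := by rw [setLIntegral_const]
      _ ≤ ∫⁻ θ in A, (M + ∫⁻ x, gaussDensity v θ x * L θ x) ∂π := setLIntegral_mono' hA hθ
      _ = M * π A + ∫⁻ θ in A, (∫⁻ x, gaussDensity v θ x * L θ x) ∂π := by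
          rw [lintegral_add_left measurable_const, setLIntegral_const]
      _ ≤ M * π A + 1 := by
          gcongr
          exact (setLIntegral_le_lintegral _ _).trans hone.le
  calc k * π A ≤ (1 + k) * π A := by gcongr; exact le_add_self
    _ ≤ M * π A + 1 := hfin
    _ ≤ M * 1 + 1 := by gcongr; exact prob_le_one
    _ = M + 1 := by rw [mul_one]

/-! ### Concentration of the Gaussian prior near a sphere -/

theorem variance_sq_gaussianReal (s : ℝ≥0) :
    Var[fun x : ℝ => x ^ 2; gaussianReal 0 s] =
      s ^ 2 * Var[fun x : ℝ => x ^ 2; gaussianReal 0 1] := by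
  have hmap : gaussianReal 0 s = (gaussianReal 0 1).map (√(s : ℝ) * ·) := by
    rw [gaussianReal_map_const_mul]
    congr 1
    · simp
    · ext; simp
  rw [hmap, variance_map (by fun_prop) (by fun_prop)]
  have : (fun x : ℝ => x ^ 2) ∘ (√(s : ℝ) * ·) = fun x => (s : ℝ) * x ^ 2 := by
    funext x
    simp [mul_pow]
  rw [this, variance_const_mul]

theorem memLp_sq_gaussianReal (s : ℝ≥0) : MemLp (fun x : ℝ => x ^ 2) 2 (gaussianReal 0 s) := by
  have h := (memLp_id_gaussianReal (μ := 0) (v := s) 4)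
  have h4 : Integrable (fun x : ℝ => ‖x‖ ^ 4) (gaussianReal 0 s) :=
    h.integrable_norm_pow (p := 4) (by norm_num)
  rw [memLp_two_iff_integrable_sq (by fun_prop)]
  refine h4.congr (ae_of_all _ fun x => ?_)
  simp only [Real.norm_eq_abs]
  rw [← pow_mul, show 2 * 2 = 4 from rfl, Even.pow_abs (by decide)]

theorem gaussPrior_sum_sq_deviation_le (n : ℕ) (s : ℝ≥0) {δ : ℝ} (hδ : 0 < δ) :
    gaussPrior (fun _ : Fin n => s) {θ | δ ≤ |∑ i, θ i ^ 2 - n * s|} ≤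
      ENNReal.ofReal (n * (s ^ 2 * Var[fun x : ℝ => x ^ 2; gaussianReal 0 1]) / δ ^ 2) := by
  have hL : ∀ _ : Fin n, MemLp (fun x : ℝ => x ^ 2) 2 (gaussianReal 0 s) :=
    fun _ => memLp_sq_gaussianReal s
  have hL' : ∀ i : Fin n, MemLp (fun θ : Fin n → ℝ => θ i ^ 2) 2 (gaussPrior fun _ => s) :=
    fun i => (hL i).comp_measurePreserving (measurePreserving_eval (fun _ => gaussianReal 0 s) i)
  have hS : MemLp (∑ i : Fin n, fun θ : Fin n → ℝ => θ i ^ 2) 2 (gaussPrior fun _ => s) :=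
    memLp_finsetSum' _ fun i _ => hL' i
  have hmean : ∫ θ, (∑ i : Fin n, fun θ : Fin n → ℝ => θ i ^ 2) θ ∂(gaussPrior fun _ => s) =
      n * s := by
    simp only [Finset.sum_apply]
    rw [integral_finsetSum _ fun i _ => (hL' i).integrable (by norm_num)]
    have h : ∀ i : Fin n, ∫ θ : Fin n → ℝ, θ i ^ 2 ∂(gaussPrior fun _ => s) = s := by
      intro i
      unfold gaussPrior
      rw [integral_comp_eval (μ := fun _ : Fin n => gaussianReal 0 s) (f := fun x : ℝ => x ^ 2)
        (by fun_prop)]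
      simpa using integral_sub_sq_gaussianReal 0 0 s
    simp [h]
  have hvar : Var[∑ i : Fin n, fun θ : Fin n → ℝ => θ i ^ 2; gaussPrior fun _ => s] =
      n * (s ^ 2 * Var[fun x : ℝ => x ^ 2; gaussianReal 0 1]) := by
    unfold gaussPrior
    rw [variance_sum_pi hL, variance_sq_gaussianReal]
    simp
  have h := meas_ge_le_variance_div_sq hS hδ
  rw [hmean, hvar] at h
  simpa only [Finset.sum_apply] using h

/-- The prior `N(0, (a / n) I)` puts all but `O(1 / n)` of its mass on a thin shell. -/
theorem one_sub_le_gaussPrior_shell {n : ℕ} (hn : 1 ≤ n) (a : ℝ≥0) {δ : ℝ} (hδ : 0 < δ) :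
    ENNReal.ofReal (1 - a ^ 2 * Var[fun x : ℝ => x ^ 2; gaussianReal 0 1] / δ ^ 2 / n) ≤
      gaussPrior (fun _ : Fin n => a / n) {θ | |∑ i, θ i ^ 2 - a| < δ} := by
  have hn' : (n : ℝ) ≠ 0 := by positivity
  have h := gaussPrior_sum_sq_deviation_le n (a / n) hδ
  have hV : 0 ≤ Var[fun x : ℝ => x ^ 2; gaussianReal 0 1] := variance_nonneg _ _
  have e1 : (n : ℝ) * ((a / n : ℝ≥0) : ℝ) = a := by push_cast; field_simp
  have e2 : (n : ℝ) * (((a / n : ℝ≥0) : ℝ) ^ 2 * Var[fun x : ℝ => x ^ 2; gaussianReal 0 1]) / δ ^ 2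
      = a ^ 2 * Var[fun x : ℝ => x ^ 2; gaussianReal 0 1] / δ ^ 2 / n := by
    push_cast; field_simp
  rw [e1, e2] at h
  have hset : {θ : Fin n → ℝ | |∑ i, θ i ^ 2 - a| < δ} =
      {θ : Fin n → ℝ | δ ≤ |∑ i, θ i ^ 2 - a|}ᶜ := by
    ext θ; simp
  have hmeas : MeasurableSet {θ : Fin n → ℝ | δ ≤ |∑ i, θ i ^ 2 - a|} :=
    measurableSet_le measurable_const (by fun_prop)
  rw [hset, prob_compl_eq_one_sub hmeas, ENNReal.ofReal_sub _ (by positivity), ENNReal.ofReal_one]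
  gcongr

/-! ### Risk of the linear rule and the finite-sample lower bound -/

/-- The unnormalised risk of the Bayes rule for the prior `N(0, (a / n) I)` at a parameter with
`‖θ‖² = T`, when the future vector has variance `1 / (ε n)`. -/
theorem linear_risk_eq {n a ε T : ℝ} (hn : 0 < n) (ha : 0 < a) (hε : 0 < ε) {s v w : ℝ}
    (hs : s = a / n) (hv : v = n⁻¹) (hw : w = n⁻¹ / ε) :
    n * (1 / 2 * (Real.log ((s * v / (s + v) + w) / w) + w / (s * v / (s + v) + w) - 1)) +
      1 / (2 * (s * v / (s + v) + w)) *
        (n * ((s / (s + v)) ^ 2 * v) + (1 - s / (s + v)) ^ 2 * T) =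
    n / 2 * (Real.log (1 + ε * (a / (1 + a))) +
      ε * (1 / (1 + a)) ^ 2 * (T - a) / (1 + ε * (a / (1 + a)))) := by
  subst hs hv hw
  have h1 : (a / n * n⁻¹ / (a / n + n⁻¹) + n⁻¹ / ε) / (n⁻¹ / ε) = 1 + ε * (a / (1 + a)) := by
    field_simp
    ring
  rw [h1]
  have h2 : n⁻¹ / ε / (a / n * n⁻¹ / (a / n + n⁻¹) + n⁻¹ / ε) = 1 / (1 + ε * (a / (1 + a))) := by
    rw [← h1, one_div_div]
  have h3 : 1 / (2 * (a / n * n⁻¹ / (a / n + n⁻¹) + n⁻¹ / ε)) =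
      n * ε / 2 / (1 + ε * (a / (1 + a))) := by
    rw [← h1]; field_simp
  have h4 : a / n / (a / n + n⁻¹) = a / (1 + a) := by field_simp; ring
  rw [h2, h3, h4]
  field_simp
  ring

/-- The Bayes lower bound with a Gaussian prior concentrated inside the ball. The prior has total
variance `C - δ`, so that the shell of width `δ` about its typical radius lies in the ball. -/
theorem ofReal_le_of_risk_le_on_l2Ball {n : ℕ} (hn : 1 ≤ n) {C δ r : ℝ} {a ε : ℝ≥0} (hδ : 0 < δ)
    (ha : 0 < a) (haC : (a : ℝ) + δ = C) (hε : 0 < ε) (hr : 0 ≤ r)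
    (hrle : r ≤ 1 / 2 * (Real.log (1 + ε * (a / (1 + a))) - ε * δ))
    {p : (Fin n → ℝ) → (Fin n → ℝ) → ℝ≥0∞} (hp : IsPredictiveDensity p) {M : ℝ≥0∞}
    (hM : ∀ θ ∈ l2Ball n C, ∫⁻ x, klDiv (gaussLaw (noise n / ε) θ) (volume.withDensity (p x))
      ∂(gaussLaw (noise n) θ) ≤ M) :
    ENNReal.ofReal (n * r * (1 - a ^ 2 * Var[fun x : ℝ => x ^ 2; gaussianReal 0 1] / δ ^ 2 / n)
      - 1) ≤ M := by
  have hn' : (0 : ℝ) < n := by exact_mod_cast hn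
  have hn'' : (n : ℝ≥0) ≠ 0 := by positivity
  have hv := noise_ne_zero hn
  have ha' : (0 : ℝ) < a := by exact_mod_cast ha
  have hε' : (0 : ℝ) < ε := by exact_mod_cast hε
  have hw : noise n / ε ≠ 0 := by positivity
  have hs : a / (n : ℝ≥0) ≠ 0 := by positivity
  have hA : MeasurableSet {θ : Fin n → ℝ | |∑ i, θ i ^ 2 - a| < δ} :=
    measurableSet_lt (by fun_prop) measurable_const
  have hsub : ∀ θ ∈ {θ : Fin n → ℝ | |∑ i, θ i ^ 2 - a| < δ}, θ ∈ l2Ball n C := by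
    intro θ hθ
    have := (abs_lt.1 (show |∑ i, θ i ^ 2 - (a : ℝ)| < δ from hθ)).2
    change ∑ i, θ i ^ 2 ≤ C
    linarith
  have h := mul_gaussPrior_le_of_risk_le hs hv hw hp hA (M := M) (k := ENNReal.ofReal (n * r))
    (fun θ hθ => hM θ (hsub θ hθ)) ?_
  · rw [ENNReal.ofReal_sub _ zero_le_one, ENNReal.ofReal_one, tsub_le_iff_right,
      ENNReal.ofReal_mul (by positivity)]
    refine le_trans ?_ h
    gcongr
    exact one_sub_le_gaussPrior_shell hn a hδ
  · intro θ hθ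
    have hlow := (abs_lt.1 (show |∑ i, θ i ^ 2 - (a : ℝ)| < δ from hθ)).1
    have := lintegral_klDiv_linear (v := noise n) hw
      (show a / (n : ℝ≥0) * noise n / (a / n + noise n) + noise n / ε ≠ 0 by positivity)
      ((a / n : ℝ≥0) / ((a / n : ℝ≥0) + noise n)) θ
    rw [this]
    refine ENNReal.ofReal_le_ofReal ?_
    simp only [NNReal.coe_add, NNReal.coe_div, NNReal.coe_mul, NNReal.coe_natCast]
    rw [linear_risk_eq hn' ha' hε' rfl (show ((noise n : ℝ≥0) : ℝ) = (n : ℝ)⁻¹ by simp [noise])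
      (by simp [noise])]
    have hα : 0 ≤ (ε : ℝ) * (a / (1 + a)) := by positivity
    have hsq : (1 / (1 + a) : ℝ) ^ 2 ≤ 1 := by
      refine pow_le_one₀ (by positivity) ?_
      rw [div_le_one (by positivity)]
      linarith
    have hkey : -(ε * δ : ℝ) ≤ ε * (1 / (1 + a)) ^ 2 * (∑ i, θ i ^ 2 - a) /
        (1 + ε * (a / (1 + a))) := by
      rw [le_div_iff₀ (by positivity)]
      have h1 : -(ε * (1 / (1 + a) : ℝ) ^ 2 * δ) ≤
          ε * (1 / (1 + a)) ^ 2 * (∑ i, θ i ^ 2 - a) := by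
        rw [← mul_neg]
        gcongr
      have h2 : (ε * (1 / (1 + a) : ℝ) ^ 2 * δ) ≤ ε * δ := by
        have : (ε * δ : ℝ) * (1 / (1 + a) : ℝ) ^ 2 ≤ ε * δ * 1 := by gcongr
        linarith
      have h3 : 0 ≤ (ε * δ : ℝ) * (ε * (a / (1 + a))) := by positivity
      linarith
    calc (n : ℝ) * r ≤ n * (1 / 2 * (Real.log (1 + ε * (a / (1 + a))) - ε * δ)) := by gcongr
      _ = n / 2 * (Real.log (1 + ε * (a / (1 + a))) + -(ε * δ)) := by ring
      _ ≤ _ := by gcongr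

/-! ### Plug-in densities and squared error -/

theorem lintegral_klDiv_plugIn {n : ℕ} (v : ℝ≥0) {w : ℝ≥0} (hw : w ≠ 0) (θ : Fin n → ℝ)
    (est : (Fin n → ℝ) → Fin n → ℝ) :
    ∫⁻ x, klDiv (gaussLaw w θ) (volume.withDensity (gaussDensity w (est x))) ∂(gaussLaw v θ) =
      ENNReal.ofReal (1 / (2 * w)) *
        ∫⁻ x, ENNReal.ofReal (∑ i, (est x i - θ i) ^ 2) ∂(gaussLaw v θ) := by
  rw [← lintegral_const_mul' _ _ ENNReal.ofReal_ne_top]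
  refine lintegral_congr fun x => ?_
  have hw' : (w : ℝ) ≠ 0 := by positivity
  rw [gaussLaw_eq_withDensity hw, (klDiv_gaussDensity hw hw _ _).2,
    ← ENNReal.ofReal_mul (by positivity)]
  congr 1
  simp [div_self hw', Finset.mul_sum]

theorem klRisk_plugInDensity {n : ℕ} (hn : 1 ≤ n) (est : (Fin n → ℝ) → Fin n → ℝ)
    (θ : Fin n → ℝ) : klRisk n θ (plugInDensity n est) = 2⁻¹ * sqRisk θ est := by
  have hn' : (0 : ℝ) < n := by exact_mod_cast hn
  have h := lintegral_klDiv_plugIn (noise n) (noise_ne_zero hn) θ est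
  have e : ENNReal.ofReal (1 / (2 * (noise n : ℝ))) = n * 2⁻¹ := by
    have : 1 / (2 * (noise n : ℝ)) = n * 2⁻¹ := by
      simp only [noise, NNReal.coe_inv, NNReal.coe_natCast]; field_simp
    rw [this, ENNReal.ofReal_mul hn'.le, ENNReal.ofReal_natCast,
      ENNReal.ofReal_inv_of_pos two_pos, ENNReal.ofReal_ofNat]
  rw [e] at h
  unfold klRisk sqRisk plugInDensity
  rw [h, mul_assoc, ← mul_assoc, ENNReal.inv_mul_cancel _ (ENNReal.natCast_ne_top n), one_mul]
  exact_mod_cast (by omega : n ≠ 0)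

theorem plugInMinimaxRisk_eq {n : ℕ} (hn : 1 ≤ n) (Θ : Set (Fin n → ℝ)) :
    plugInMinimaxRisk n n Θ = 2⁻¹ * sqMinimaxRisk n Θ := by
  unfold plugInMinimaxRisk sqMinimaxRisk
  simp_rw [klRisk_plugInDensity hn]
  simp_rw [ENNReal.mul_iInf_of_ne (a := 2⁻¹) (by simp) (by simp), ENNReal.mul_iSup]

/-! ### Bounds on the minimax risks -/

theorem minimaxRisk_le_linearMinimaxRisk {n : ℕ} (hn : 1 ≤ n) (Θ : Set (Fin n → ℝ)) :
    minimaxRisk n n Θ ≤ linearMinimaxRisk n n Θ :=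
  le_iInf fun s => iInf₂_le _ (isPredictiveDensity_linearDensity hn hn s)

theorem linearMinimaxRisk_le {n : ℕ} (hn : 1 ≤ n) {C : ℝ} (hC : 0 < C) :
    linearMinimaxRisk n n (l2Ball n C) ≤
      ENNReal.ofReal (1 / 2 * Real.log ((1 + 2 * C) / (1 + C))) := by
  lift C to ℝ≥0 using hC.le
  have hn' : (0 : ℝ) < n := by exact_mod_cast hn
  have hv := noise_ne_zero hn
  have hs : C / (n : ℝ≥0) ≠ 0 := by
    have : C ≠ 0 := by exact_mod_cast hC.ne'
    have : (n : ℝ≥0) ≠ 0 := by exact_mod_cast hn'.ne'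
    positivity
  refine iInf_le_of_le (fun _ => C / n) (iSup₂_le fun θ hθ => ?_)
  unfold klRisk
  have hlin : ∀ x, linearDensity (n := n) n (fun _ => C / n) x = gaussDensity
      (C / n * noise n / (C / n + noise n) + noise n)
      (fun i => ((C / n : ℝ≥0) / ((C / n : ℝ≥0) + noise n) : ℝ) * x i) :=
    fun x => funext fun y => linearDensity_const hn hn hs x y
  simp_rw [hlin]
  rw [lintegral_klDiv_linear hv (by positivity)]
  simp only [NNReal.coe_add, NNReal.coe_div, NNReal.coe_mul, NNReal.coe_natCast]
  rw [linear_risk_eq hn' hC one_pos rfl (show ((noise n : ℝ≥0) : ℝ) = (n : ℝ)⁻¹ by simp [noise])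
      (by simp [noise]), mul_comm, ← div_eq_mul_inv]
  refine ENNReal.div_le_of_le_mul ?_
  rw [← ENNReal.ofReal_natCast n, ← ENNReal.ofReal_mul' hn'.le]
  refine ENNReal.ofReal_le_ofReal ?_
  have e : (1 + 2 * (C : ℝ)) / (1 + C) = 1 + 1 * (C / (1 + C)) := by field_simp; ring
  rw [e]
  have hθ' : ∑ i, θ i ^ 2 - (C : ℝ) ≤ 0 := sub_nonpos.2 hθ
  have : 1 * (1 / (1 + C)) ^ 2 * (∑ i, θ i ^ 2 - (C : ℝ)) / (1 + 1 * (C / (1 + C))) ≤ 0 :=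
    div_nonpos_of_nonpos_of_nonneg (mul_nonpos_of_nonneg_of_nonpos (by positivity) hθ')
      (by positivity)
  nlinarith

theorem sqMinimaxRisk_le {n : ℕ} (hn : 1 ≤ n) {C : ℝ} (hC : 0 < C) :
    sqMinimaxRisk n (l2Ball n C) ≤ ENNReal.ofReal (C / (1 + C)) := by
  have hn' : (0 : ℝ) < n := by exact_mod_cast hn
  refine iInf₂_le_of_le (fun x i => C / (1 + C) * x i) (by fun_prop) (iSup₂_le fun θ hθ => ?_)
  have h := lintegral_linear_sub_sq_gaussLaw (noise n) θ (C / (1 + C)) le_rfl zero_le_one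
  simp only [zero_add, one_mul] at h
  unfold sqRisk
  rw [h]
  refine ENNReal.ofReal_le_ofReal ?_
  have hθ' : ∑ i, θ i ^ 2 ≤ C := hθ
  simp only [noise, NNReal.coe_inv, NNReal.coe_natCast]
  calc (n : ℝ) * 0 + (n * ((C / (1 + C)) ^ 2 * (n : ℝ)⁻¹) + (1 - C / (1 + C)) ^ 2 * ∑ i, θ i ^ 2)
      ≤ n * 0 + (n * ((C / (1 + C)) ^ 2 * (n : ℝ)⁻¹) + (1 - C / (1 + C)) ^ 2 * C) := by gcongr
    _ = C / (1 + C) := by field_simp; ring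

theorem ofReal_le_minimaxRisk {n : ℕ} (hn : 1 ≤ n) {C δ r : ℝ} {a : ℝ≥0} (hδ : 0 < δ)
    (ha : 0 < a) (haC : (a : ℝ) + δ = C) (hr : 0 ≤ r)
    (hrle : r ≤ 1 / 2 * (Real.log (1 + a / (1 + a)) - δ)) :
    ENNReal.ofReal (r * (1 - a ^ 2 * Var[fun x : ℝ => x ^ 2; gaussianReal 0 1] / δ ^ 2 / n)
      - 1 / n) ≤ minimaxRisk n n (l2Ball n C) := by
  have hn' : (0 : ℝ) < n := by exact_mod_cast hn
  have hn0 : (n : ℝ≥0∞) ≠ 0 := by exact_mod_cast (by omega : n ≠ 0)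
  refine le_iInf₂ fun p hp => ?_
  have h := ofReal_le_of_risk_le_on_l2Ball hn (ε := 1) hδ ha haC one_pos hr (by simpa using hrle)
    hp (M := n * ⨆ θ ∈ l2Ball n C, klRisk n θ p) ?_
  · have e : r * (1 - a ^ 2 * Var[fun x : ℝ => x ^ 2; gaussianReal 0 1] / δ ^ 2 / n) - 1 / n =
        (n * r * (1 - a ^ 2 * Var[fun x : ℝ => x ^ 2; gaussianReal 0 1] / δ ^ 2 / n) - 1) / n := by
      field_simp
    rw [e, ENNReal.ofReal_div_of_pos hn', ENNReal.ofReal_natCast]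
    exact ENNReal.div_le_of_le_mul' h
  · intro θ hθ
    refine le_trans (le_of_eq ?_)
      (mul_le_mul_right (le_iSup₂ (f := fun θ _ => klRisk n θ p) θ hθ) _)
    unfold klRisk
    rw [div_one, ← mul_assoc, ENNReal.mul_inv_cancel hn0 (ENNReal.natCast_ne_top n), one_mul]

/-- The lower bound for squared error comes from prediction of a future vector with variance
`1 / (ε n)`: for small `ε` the benefit of leaving the plug-in class disappears. -/
theorem ofReal_le_sqMinimaxRisk {n : ℕ} (hn : 1 ≤ n) {C δ r : ℝ} {a ε : ℝ≥0} (hδ : 0 < δ)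
    (ha : 0 < a) (haC : (a : ℝ) + δ = C) (hε : 0 < ε) (hr : 0 ≤ r)
    (hrle : r ≤ 1 / 2 * (Real.log (1 + ε * (a / (1 + a))) - ε * δ)) :
    ENNReal.ofReal (2 / ε * (r * (1 - a ^ 2 * Var[fun x : ℝ => x ^ 2; gaussianReal 0 1]
      / δ ^ 2 / n) - 1 / n)) ≤ sqMinimaxRisk n (l2Ball n C) := by
  have hn' : (0 : ℝ) < n := by exact_mod_cast hn
  have hε' : (0 : ℝ) < ε := by exact_mod_cast hε
  have hw : noise n / ε ≠ 0 := by
    have := noise_ne_zero hn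
    positivity
  refine le_iInf₂ fun est hest => ?_
  have e0 : 1 / (2 * ((noise n / ε : ℝ≥0) : ℝ)) = n * ε / 2 := by
    simp only [noise, NNReal.coe_div, NNReal.coe_inv, NNReal.coe_natCast]
    field_simp
  have h := ofReal_le_of_risk_le_on_l2Ball hn hδ ha haC hε hr hrle
    (isPredictiveDensity_gaussDensity hw hest)
    (M := ENNReal.ofReal (n * ε / 2) * ⨆ θ ∈ l2Ball n C, sqRisk θ est) ?_
  · have e : 2 / ε * (r * (1 - a ^ 2 * Var[fun x : ℝ => x ^ 2; gaussianReal 0 1] / δ ^ 2 / n)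
        - 1 / n) = (n * r * (1 - a ^ 2 * Var[fun x : ℝ => x ^ 2; gaussianReal 0 1] / δ ^ 2 / n)
          - 1) / (n * ε / 2) := by
      field_simp
    rw [e, ENNReal.ofReal_div_of_pos (by positivity)]
    exact ENNReal.div_le_of_le_mul' h
  · intro θ hθ
    rw [lintegral_klDiv_plugIn _ hw, e0]
    exact mul_le_mul_right (le_iSup₂ (f := fun θ _ => sqRisk θ est) θ hθ) _

/-! ### Limits -/

/-- A sequence bounded above by its prospective limit, and below by real sequences whose limits
`l δ` approach it as `δ → 0`, converges. -/
theorem tendsto_ofReal_of_bounds {R : ℕ → ℝ≥0∞} {L : ℝ} {f : ℝ → ℕ → ℝ} {l : ℝ → ℝ}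
    (hup : ∀ᶠ n in atTop, R n ≤ ENNReal.ofReal L)
    (hlow : ∀ᶠ δ in 𝓝[>] 0, ∀ᶠ n in atTop, ENNReal.ofReal (f δ n) ≤ R n)
    (hf : ∀ δ, Tendsto (f δ) atTop (𝓝 (l δ))) (hl : Tendsto l (𝓝[>] 0) (𝓝 L)) :
    Tendsto R atTop (𝓝 (ENNReal.ofReal L)) := by
  refine tendsto_order.2 ⟨fun b hb => ?_, fun b hb => hup.mono fun n hn => hn.trans_lt hb⟩
  obtain ⟨δ, hδ, hbδ⟩ :=
    (hlow.and ((ENNReal.tendsto_ofReal hl).eventually_const_lt hb)).exists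
  filter_upwards [hδ, (ENNReal.tendsto_ofReal (hf δ)).eventually_const_lt hbδ] with n h1 h2
    using h2.trans_le h1

theorem tendsto_mul_one_sub_div (r κ : ℝ) :
    Tendsto (fun n : ℕ => r * (1 - κ / n) - 1 / n) atTop (𝓝 r) := by
  have h1 := tendsto_const_div_atTop_nhds_zero_nat κ
  have h2 := tendsto_const_div_atTop_nhds_zero_nat (1 : ℝ)
  simpa using ((h1.const_sub 1).const_mul r).sub h2

theorem tendsto_minimaxRisk {C : ℝ} (hC : 0 < C) :
    Tendsto (fun n : ℕ => minimaxRisk n n (l2Ball n C)) atTop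
      (𝓝 (ENNReal.ofReal (1 / 2 * Real.log ((1 + 2 * C) / (1 + C))))) := by
  let r : ℝ → ℝ := fun δ => 1 / 2 * (Real.log (1 + (C - δ) / (1 + (C - δ))) - δ)
  have e : (1 + 2 * C) / (1 + C) = 1 + C / (1 + C) := by field_simp; ring
  have hpos : 0 < C / (1 + C) := by positivity
  have hr : Tendsto r (𝓝[>] 0) (𝓝 (1 / 2 * Real.log ((1 + 2 * C) / (1 + C)))) := by
    have hc : ContinuousAt r 0 := by
      have h1 : 1 + (C - 0) ≠ 0 := by simp; positivity
      have h2 : 1 + (C - 0) / (1 + (C - 0)) ≠ 0 := by simp; positivity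
      fun_prop (disch := assumption)
    have h := hc.tendsto
    simp only [r, sub_zero] at h
    rw [e]
    exact h.mono_left nhdsWithin_le_nhds
  have hlim : 0 < 1 / 2 * Real.log ((1 + 2 * C) / (1 + C)) := by
    rw [e]
    have := Real.log_pos (show 1 < 1 + C / (1 + C) by linarith)
    positivity
  refine tendsto_ofReal_of_bounds (l := r) (f := fun δ n => r δ * (1 - (C - δ) ^ 2 *
    Var[fun x : ℝ => x ^ 2; gaussianReal 0 1] / δ ^ 2 / n) - 1 / n) ?_ ?_
    (fun δ => tendsto_mul_one_sub_div _ _) hr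
  · filter_upwards [eventually_ge_atTop 1] with n hn
    exact (minimaxRisk_le_linearMinimaxRisk hn _).trans (linearMinimaxRisk_le hn hC)
  · filter_upwards [hr.eventually_const_lt hlim, Ioo_mem_nhdsGT hC] with δ hδ hδC
    filter_upwards [eventually_ge_atTop 1] with n hn
    have hmem : 0 < C - δ := sub_pos.2 hδC.2
    exact ofReal_le_minimaxRisk hn (a := ⟨C - δ, hmem.le⟩) hδC.1 hmem (sub_add_cancel C δ)
      hδ.le le_rfl

theorem tendsto_linearMinimaxRisk {C : ℝ} (hC : 0 < C) :
    Tendsto (fun n : ℕ => linearMinimaxRisk n n (l2Ball n C)) atTop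
      (𝓝 (ENNReal.ofReal (1 / 2 * Real.log ((1 + 2 * C) / (1 + C))))) := by
  refine tendsto_of_tendsto_of_tendsto_of_le_of_le' (tendsto_minimaxRisk hC) tendsto_const_nhds
    ?_ ?_
  · filter_upwards [eventually_ge_atTop 1] with n hn using minimaxRisk_le_linearMinimaxRisk hn _
  · filter_upwards [eventually_ge_atTop 1] with n hn using linearMinimaxRisk_le hn hC

theorem tendsto_sqMinimaxRisk {C : ℝ} (hC : 0 < C) :
    Tendsto (fun n : ℕ => sqMinimaxRisk n (l2Ball n C)) atTop
      (𝓝 (ENNReal.ofReal (C / (1 + C)))) := by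
  -- The future variance `1 / (δ n)` and the shell width `δ` are taken to their limits together.
  let l : ℝ → ℝ := fun δ =>
    (C - δ) / (1 + (C - δ)) / (1 + δ * ((C - δ) / (1 + (C - δ)))) - δ
  let r : ℝ → ℝ := fun δ => δ / 2 * l δ
  have hpos : 0 < C / (1 + C) := by positivity
  have hl : Tendsto l (𝓝[>] 0) (𝓝 (C / (1 + C))) := by
    have hc : ContinuousAt l 0 := by
      have h1 : 1 + (C - 0) ≠ 0 := by simp; positivity
      have h2 : 1 + 0 * ((C - 0) / (1 + (C - 0))) ≠ 0 := by simp
      fun_prop (disch := assumption)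
    have h := hc.tendsto
    simp only [l, sub_zero, zero_mul, add_zero, div_one] at h
    exact h.mono_left nhdsWithin_le_nhds
  refine tendsto_ofReal_of_bounds (l := fun δ => 2 / δ * r δ) (f := fun δ n =>
    2 / δ * (r δ * (1 - (C - δ) ^ 2 * Var[fun x : ℝ => x ^ 2; gaussianReal 0 1] / δ ^ 2 / n)
      - 1 / n)) ?_ ?_ (fun δ => (tendsto_mul_one_sub_div _ _).const_mul _) ?_
  · filter_upwards [eventually_ge_atTop 1] with n hn using sqMinimaxRisk_le hn hC
  · filter_upwards [hl.eventually_const_lt hpos, Ioo_mem_nhdsGT hC] with δ hδ hδC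
    filter_upwards [eventually_ge_atTop 1] with n hn
    have hmem : 0 < C - δ := sub_pos.2 hδC.2
    have hδ0 : 0 < δ := hδC.1
    refine ofReal_le_sqMinimaxRisk hn (a := ⟨C - δ, hmem.le⟩) (ε := ⟨δ, hδ0.le⟩) hδ0 hmem
      (sub_add_cancel C δ) hδ0 (by positivity) ?_
    change δ / 2 * l δ ≤ 1 / 2 * (Real.log (1 + δ * ((C - δ) / (1 + (C - δ)))) - δ * δ)
    have hα : 0 < δ * ((C - δ) / (1 + (C - δ))) := by positivity
    have hlog := Real.one_sub_inv_le_log_of_pos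
      (show 0 < 1 + δ * ((C - δ) / (1 + (C - δ))) by positivity)
    have hid : δ * l δ = 1 - (1 + δ * ((C - δ) / (1 + (C - δ))))⁻¹ - δ * δ := by
      simp only [l]
      field_simp
      ring
    linarith
  · refine hl.congr' ?_
    filter_upwards [self_mem_nhdsWithin] with δ hδ
    have : δ ≠ 0 := ne_of_gt hδ
    simp only [r]
    field_simp

theorem half_log_lt {C : ℝ} (hC : 0 < C) :
    1 / 2 * Real.log ((1 + 2 * C) / (1 + C)) < C / (2 * (1 + C)) := by
  have h := Real.log_lt_sub_one_of_pos (show 0 < (1 + 2 * C) / (1 + C) by positivity)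
    (by rw [Ne, div_eq_one_iff_eq (by positivity)]; linarith)
  have e : C / (2 * (1 + C)) = 1 / 2 * ((1 + 2 * C) / (1 + C) - 1) := by field_simp; ring
  rw [e]
  gcongr

theorem tendsto_plugInMinimaxRisk {C : ℝ} (hC : 0 < C) :
    Tendsto (fun n : ℕ => plugInMinimaxRisk n n (l2Ball n C)) atTop
      (𝓝 (ENNReal.ofReal (C / (2 * (1 + C))))) := by
  have h := ENNReal.Tendsto.const_mul (a := 2⁻¹) (tendsto_sqMinimaxRisk hC) (Or.inr (by simp))
  have e : ENNReal.ofReal (C / (2 * (1 + C))) = 2⁻¹ * ENNReal.ofReal (C / (1 + C)) := by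
    have : C / (2 * (1 + C)) = 2⁻¹ * (C / (1 + C)) := by field_simp
    rw [this, ENNReal.ofReal_mul (by positivity), ENNReal.ofReal_inv_of_pos two_pos,
      ENNReal.ofReal_ofNat]
  rw [e]
  refine h.congr' ?_
  filter_upwards [eventually_ge_atTop 1] with n hn using (plugInMinimaxRisk_eq hn _).symm

end PredDensity

theorem mainTheorem7 (C : ℝ) (hC : 0 < C) :
    -- the overall and the linear minimax risks
    Tendsto (fun n : ℕ => PredDensity.minimaxRisk n n (PredDensity.l2Ball n C)) atTop
      (𝓝 (ENNReal.ofReal (1 / 2 * Real.log ((1 + 2 * C) / (1 + C))))) ∧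
    Tendsto (fun n : ℕ => PredDensity.linearMinimaxRisk n n (PredDensity.l2Ball n C)) atTop
      (𝓝 (ENNReal.ofReal (1 / 2 * Real.log ((1 + 2 * C) / (1 + C))))) ∧
    -- the plug-in risk is half the squared error risk
    (∀ n : ℕ, 1 ≤ n → ∀ est : (Fin n → ℝ) → Fin n → ℝ, Measurable est → ∀ θ : Fin n → ℝ,
      PredDensity.klRisk n θ (PredDensity.plugInDensity n est) =
        2⁻¹ * PredDensity.sqRisk θ est) ∧
    (∀ n : ℕ, 1 ≤ n → PredDensity.plugInMinimaxRisk n n (PredDensity.l2Ball n C) =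
      2⁻¹ * PredDensity.sqMinimaxRisk n (PredDensity.l2Ball n C)) ∧
    -- the minimax squared error risk and the plug-in minimax risk
    Tendsto (fun n : ℕ => PredDensity.sqMinimaxRisk n (PredDensity.l2Ball n C)) atTop
      (𝓝 (ENNReal.ofReal (C / (1 + C)))) ∧
    Tendsto (fun n : ℕ => PredDensity.plugInMinimaxRisk n n (PredDensity.l2Ball n C)) atTop
      (𝓝 (ENNReal.ofReal (C / (2 * (1 + C))))) ∧
    -- strict comparison, of the limits and hence of the risks for all large `n`
    1 / 2 * Real.log ((1 + 2 * C) / (1 + C)) < C / (2 * (1 + C)) ∧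
    (∀ᶠ n : ℕ in atTop, PredDensity.minimaxRisk n n (PredDensity.l2Ball n C) <
      PredDensity.plugInMinimaxRisk n n (PredDensity.l2Ball n C)) := by
  have hR := PredDensity.tendsto_minimaxRisk hC
  have hP := PredDensity.tendsto_plugInMinimaxRisk hC
  have hlt := PredDensity.half_log_lt hC
  refine ⟨hR, PredDensity.tendsto_linearMinimaxRisk hC,
    fun n hn est _ θ => PredDensity.klRisk_plugInDensity hn est θ,
    fun n hn => PredDensity.plugInMinimaxRisk_eq hn _, PredDensity.tendsto_sqMinimaxRisk hC, hP,
    hlt, hR.eventually_lt hP ?_⟩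
  exact (ENNReal.ofReal_lt_ofReal_iff (by positivity)).2 hlt
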